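/- For a connected simple graph $G$ on $n$ vertices with Laplacian matrix $L=D-A$ (degree matrix minus adjacency matrix) and Moore–Penrose pseudoinverse $L^{+}$ of $L$, let $d_B^2(u,v)=((L^{+})^2)_{uu}+((L^{+})^2)_{vv}-2((L^{+})^2)_{uv}$ be the squared biharmonic distance, and let $$BH(G)=\frac12\sum_{u\in V(G)}\sum_{v\in V(G)}d_B^2(u,v)=n\sum_{i=2}^{n}\frac{1}{\lambda_i(G)^2}$$ be the biharmonic index, where $\lambda_1(G)\le\dots\le\lambda_n(G)$ are the eigenvalues of $L$. **Theorem.** Let $T$ be a tree on $n\ge 8$ vertices. If the diameter $d(T)$ satisfies $d(T)\ge \pi\sqrt[4]{\frac{7n}{8}}-1$, then $$BH(T)>BH(K_{1,n-1}),$$ where $K_{1,n-1}$ is the star on $n$ vertices. -/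

import Mathlib

open scoped Matrix

noncomputable section

namespace Biharmonic

variable {V : Type*} [Fintype V] [DecidableEq V]

/-- The pseudoinverse of a real symmetric matrix `A = U diag(μ) Uᵀ`, namely
`U diag(μ⁺) Uᵀ` with `μ⁺ = 1/μ` for `μ ≠ 0` and `μ⁺ = 0` for `μ = 0` (which is Lean's `μ⁻¹`). -/
def pinv {A : Matrix V V ℝ} (hA : A.IsHermitian) : Matrix V V ℝ :=
  (hA.eigenvectorUnitary : Matrix V V ℝ) * Matrix.diagonal (fun i => (hA.eigenvalues i)⁻¹) *
    star (hA.eigenvectorUnitary : Matrix V V ℝ)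

/-- The Moore-Penrose pseudoinverse `L⁺` of the Laplacian matrix `L = D - A` of a graph. -/
def lapPinv (G : SimpleGraph V) [DecidableRel G.Adj] : Matrix V V ℝ :=
  pinv (G.isHermitian_lapMatrix ℝ)

/-- The squared biharmonic distance
`d_B²(u,v) = (L⁺²)_{uu} + (L⁺²)_{vv} - 2 (L⁺²)_{uv}`. -/
def sqDist (G : SimpleGraph V) [DecidableRel G.Adj] (u v : V) : ℝ :=
  (lapPinv G ^ 2) u u + (lapPinv G ^ 2) v v - 2 * (lapPinv G ^ 2) u v

/-- The biharmonic index `BH(G) = (1/2) ∑_u ∑_v d_B²(u,v)`. -/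
def BH (G : SimpleGraph V) [DecidableRel G.Adj] : ℝ :=
  (1 / 2) * ∑ u : V, ∑ v : V, sqDist G u v

/-- The Laplacian eigenvalues in increasing order, with multiplicity; index `i` (from `0`) is the
`(i+1)`-st smallest one. (Mathlib's `eigenvalues₀` is in decreasing order.) -/
def lapEigenvalue (G : SimpleGraph V) [DecidableRel G.Adj] (i : Fin (Fintype.card V)) : ℝ :=
  (G.isHermitian_lapMatrix ℝ).eigenvalues₀ i.rev

instance decidableAdjCompleteBipartite (p q : ℕ) :
    DecidableRel (completeBipartiteGraph (Fin p) (Fin q)).Adj :=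
  fun x y => inferInstanceAs
    (Decidable (x.isLeft = true ∧ y.isRight = true ∨ x.isRight = true ∧ y.isLeft = true))

theorem spectral {A : Matrix V V ℝ} (hA : A.IsHermitian) :
    A = (hA.eigenvectorUnitary : Matrix V V ℝ) * Matrix.diagonal hA.eigenvalues *
      star (hA.eigenvectorUnitary : Matrix V V ℝ) := by
  have h := hA.spectral_theorem
  rw [Unitary.conjStarAlgAut_apply] at h
  exact h

theorem conj_mul {A : Matrix V V ℝ} (hA : A.IsHermitian) (a b : V → ℝ) :
    ((hA.eigenvectorUnitary : Matrix V V ℝ) * Matrix.diagonal a *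
      star (hA.eigenvectorUnitary : Matrix V V ℝ)) *
    ((hA.eigenvectorUnitary : Matrix V V ℝ) * Matrix.diagonal b *
      star (hA.eigenvectorUnitary : Matrix V V ℝ)) =
    (hA.eigenvectorUnitary : Matrix V V ℝ) * Matrix.diagonal (fun i => a i * b i) *
      star (hA.eigenvectorUnitary : Matrix V V ℝ) := by
  have h : star (hA.eigenvectorUnitary : Matrix V V ℝ) * (hA.eigenvectorUnitary : Matrix V V ℝ)
      = 1 := Unitary.coe_star_mul_self _
  rw [← Matrix.diagonal_mul_diagonal]
  simp only [Matrix.mul_assoc]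
  congr 2
  rw [← Matrix.mul_assoc (star _), h, Matrix.one_mul]

theorem conj_symm {A : Matrix V V ℝ} (hA : A.IsHermitian) (a : V → ℝ) :
    ((hA.eigenvectorUnitary : Matrix V V ℝ) * Matrix.diagonal a *
      star (hA.eigenvectorUnitary : Matrix V V ℝ)).IsHermitian := by
  rw [Matrix.star_eq_conjTranspose]
  exact Matrix.isHermitian_mul_mul_conjTranspose _ (Matrix.isHermitian_diagonal a)

/-- `pinv` satisfies the four Penrose equations (over `ℝ`, Hermitian means symmetric). -/
theorem pinv_penrose {A : Matrix V V ℝ} (hA : A.IsHermitian) :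
    A * pinv hA * A = A ∧ pinv hA * A * pinv hA = pinv hA ∧
      (A * pinv hA).IsHermitian ∧ (pinv hA * A).IsHermitian := by
  have e := spectral hA
  have h1 : A * pinv hA = (hA.eigenvectorUnitary : Matrix V V ℝ) *
      Matrix.diagonal (fun i => hA.eigenvalues i * (hA.eigenvalues i)⁻¹) *
      star (hA.eigenvectorUnitary : Matrix V V ℝ) := by
    conv_lhs => enter [1]; rw [e]
    exact conj_mul hA _ _
  have h2 : pinv hA * A = (hA.eigenvectorUnitary : Matrix V V ℝ) *
      Matrix.diagonal (fun i => (hA.eigenvalues i)⁻¹ * hA.eigenvalues i) *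
      star (hA.eigenvectorUnitary : Matrix V V ℝ) := by
    conv_lhs => enter [2]; rw [e]
    exact conj_mul hA _ _
  refine ⟨?_, ?_, ?_, ?_⟩
  · rw [h1]
    conv_lhs => enter [2]; rw [e]
    rw [conj_mul]
    simp only [mul_inv_mul_cancel]
    exact e.symm
  · rw [h2, pinv, conj_mul]
    congr 3
    ext i
    by_cases h : hA.eigenvalues i = 0 <;> simp [h]
  · rw [h1]; exact conj_symm hA _
  · rw [h2]; exact conj_symm hA _

/-- The spectral form of the biharmonic index: `BH(G) = n ∑_{i=2}^n 1/λ_i²`. -/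
theorem BH_eq_spectral (G : SimpleGraph V) [DecidableRel G.Adj] (hG : G.Connected) :
    BH G = (Fintype.card V : ℝ) *
      ∑ i : Fin (Fintype.card V) with 0 < i.val, 1 / lapEigenvalue G i ^ 2 := by
  have hA := G.isHermitian_lapMatrix ℝ
  have := hG.nonempty
  have hone : lapPinv G *ᵥ (fun _ => 1) = 0 := by
    have hp : lapPinv G * lapPinv G * G.lapMatrix ℝ = lapPinv G := by
      have e := spectral hA
      have : lapPinv G = pinv hA := rfl
      rw [this]
      conv_lhs => enter [2]; rw [e]
      rw [pinv, conj_mul, conj_mul]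
      congr 3
      ext i
      by_cases h : hA.eigenvalues i = 0 <;> simp [h]
    rw [← hp, ← Matrix.mulVec_mulVec, G.lapMatrix_mulVec_const_eq_zero, Matrix.mulVec_zero]
  have hsum : ∀ u, ∑ v, (lapPinv G ^ 2) u v = 0 := by
    intro u
    have : (lapPinv G ^ 2) *ᵥ (fun _ => (1 : ℝ)) = 0 := by
      rw [pow_two, ← Matrix.mulVec_mulVec, hone, Matrix.mulVec_zero]
    simpa [Matrix.mulVec, dotProduct] using congrFun this u
  have htr : ∑ u, (lapPinv G ^ 2) u u = ∑ i, 1 / hA.eigenvalues i ^ 2 := by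
    change Matrix.trace (lapPinv G ^ 2) = _
    rw [pow_two, lapPinv, pinv, conj_mul, Matrix.trace_mul_comm, ← Matrix.mul_assoc,
      Unitary.coe_star_mul_self, Matrix.one_mul, Matrix.trace_diagonal]
    refine Finset.sum_congr rfl fun i _ => ?_
    rw [one_div, pow_two, mul_inv]
  have hall : ∑ i, 1 / hA.eigenvalues i ^ 2 =
      ∑ i : Fin (Fintype.card V), 1 / lapEigenvalue G i ^ 2 := by
    rw [← Equiv.sum_comp Fin.revPerm]
    simp only [lapEigenvalue, Fin.revPerm_apply, Fin.rev_rev]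
    exact Equiv.sum_comp (Fintype.equivOfCardEq (Fintype.card_fin (Fintype.card V))).symm
      (fun i => 1 / hA.eigenvalues₀ i ^ 2)
  have hzero : ∀ i : Fin (Fintype.card V), ¬ 0 < i.val → lapEigenvalue G i = 0 := by
    intro i hi
    have hdet : (G.lapMatrix ℝ).det = 0 := by
      rw [← Matrix.exists_mulVec_eq_zero_iff]
      exact ⟨fun _ => 1, fun h => one_ne_zero (congrFun h (Classical.arbitrary V)),
        G.lapMatrix_mulVec_const_eq_zero⟩
    rw [hA.det_eq_prod_eigenvalues, Finset.prod_eq_zero_iff] at hdet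
    obtain ⟨j, -, hj⟩ := hdet
    have hj : hA.eigenvalues j = 0 := by simpa using hj
    set k := (Fintype.equivOfCardEq (Fintype.card_fin (Fintype.card V))).symm j with hk
    have hle : hA.eigenvalues₀ i.rev ≤ hA.eigenvalues₀ k :=
      hA.eigenvalues₀_antitone (by rw [Fin.le_def, Fin.val_rev]; omega)
    have hk0 : hA.eigenvalues₀ k = 0 := hj
    have hnn := (G.posSemidef_lapMatrix ℝ).eigenvalues_nonneg
      ((Fintype.equivOfCardEq (Fintype.card_fin (Fintype.card V))) i.rev)
    simp only [Matrix.IsHermitian.eigenvalues, Equiv.symm_apply_apply] at hnn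
    exact le_antisymm (hk0 ▸ hle) hnn
  have hsplit : ∑ i : Fin (Fintype.card V) with 0 < i.val, 1 / lapEigenvalue G i ^ 2 =
      ∑ i : Fin (Fintype.card V), 1 / lapEigenvalue G i ^ 2 := by
    rw [Finset.sum_filter]
    refine Finset.sum_congr rfl fun i _ => ?_
    split_ifs with h
    · rfl
    · simp [hzero i h]
  rw [hsplit, ← hall, ← htr]
  simp only [BH, sqDist, Finset.sum_sub_distrib, Finset.sum_add_distrib, ← Finset.mul_sum, hsum,
    Finset.sum_const, Finset.card_univ, nsmul_eq_mul]
  ring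

end Biharmonic

end

/-! Everything is read off from `BH = n * ∑ 1/λ²` over the nonzero Laplacian eigenvalues. The
nonzero eigenvalues of a star are at least `1`, so its sum is at most `n - 1`.

For a tree of diameter `d`, one eigenvalue is singled out. Project the tree onto a longest geodesic,
pull back the cosine vector of that path and centre it. Edges off the geodesic are contracted, so
the energy is that of the path, while the norm does not drop. Hence some eigenvalue other than the
zero one is at most `(π/(d+1))²`, contributing at least `((d+1)/π)⁴ ≥ 7n/8`
(`exists_lapEig_le_of_tree`).

The other `n - 2` eigenvalues are controlled by the trace `2(n-1)`: bounding `1/x²` below by its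
tangent at `2` gives at least `(n-4)/4` (`sum_inv_sq_lapEig_ge_of_tree`). The total `9n/8 - 1`
exceeds `n - 1`. -/

namespace Biharmonic

/-! ### Laplacian spectrum and the variational principle -/

section Spectrum

variable {V : Type*} [Fintype V] [DecidableEq V] (G : SimpleGraph V) [DecidableRel G.Adj]

/-- The Laplacian eigenvalues, indexed by the vertices in the order of Mathlib's eigenbasis. -/
noncomputable abbrev lapEig (j : V) : ℝ := (G.isHermitian_lapMatrix ℝ).eigenvalues j

theorem lapEig_nonneg (j : V) : 0 ≤ lapEig G j :=
  (G.posSemidef_lapMatrix ℝ).eigenvalues_nonneg j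

theorem exists_lapEig_eq_zero [Nonempty V] : ∃ j, lapEig G j = 0 := by
  have h := G.det_lapMatrix_eq_zero
  rw [(G.isHermitian_lapMatrix ℝ).det_eq_prod_eigenvalues, Finset.prod_eq_zero_iff] at h
  obtain ⟨j, -, hj⟩ := h
  exact ⟨j, by simpa using hj⟩

/-- The biharmonic index is `n` times the sum of the inverse squares of the nonzero Laplacian
eigenvalues (the zero ones contribute Lean's `0⁻¹ = 0`). -/
theorem BH_eq_card_mul_sum :
    BH G = (Fintype.card V : ℝ) * ∑ j, (lapEig G j ^ 2)⁻¹ := by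
  have hA := G.isHermitian_lapMatrix ℝ
  have hone : lapPinv G *ᵥ (fun _ => 1) = 0 := by
    -- Writing `L⁺ = (L⁺)² L` shows that `L⁺` kills constants because `L` does.
    have hp : lapPinv G * lapPinv G * G.lapMatrix ℝ = lapPinv G := by
      have e := spectral hA
      have : lapPinv G = pinv hA := rfl
      rw [this]
      conv_lhs => enter [2]; rw [e]
      rw [pinv, conj_mul, conj_mul]
      congr 3
      ext i
      by_cases h : hA.eigenvalues i = 0 <;> simp [h]
    rw [← hp, ← Matrix.mulVec_mulVec, G.lapMatrix_mulVec_const_eq_zero, Matrix.mulVec_zero]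
  have hsum : ∀ u, ∑ v, (lapPinv G ^ 2) u v = 0 := by
    intro u
    have : (lapPinv G ^ 2) *ᵥ (fun _ => (1 : ℝ)) = 0 := by
      rw [pow_two, ← Matrix.mulVec_mulVec, hone, Matrix.mulVec_zero]
    simpa [Matrix.mulVec, dotProduct] using congrFun this u
  have htr : ∑ u, (lapPinv G ^ 2) u u = ∑ i, (lapEig G i ^ 2)⁻¹ := by
    change Matrix.trace (lapPinv G ^ 2) = _
    rw [pow_two, lapPinv, pinv, conj_mul, Matrix.trace_mul_comm, ← Matrix.mul_assoc,
      Unitary.coe_star_mul_self, Matrix.one_mul, Matrix.trace_diagonal]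
    refine Finset.sum_congr rfl fun i _ => ?_
    rw [pow_two, mul_inv]
  rw [← htr]
  simp only [BH, sqDist, Finset.sum_sub_distrib, Finset.sum_add_distrib, ← Finset.mul_sum, hsum,
    Finset.sum_const, Finset.card_univ, nsmul_eq_mul]
  ring

theorem lapMatrix_mulVec_apply_eq_sum (x : V → ℝ) (v : V) :
    (G.lapMatrix ℝ *ᵥ x) v = ∑ w, if G.Adj v w then x v - x w else 0 := by
  rw [SimpleGraph.lapMatrix_mulVec_apply, ← SimpleGraph.card_neighborFinset_eq_degree,
    ← nsmul_eq_mul, ← Finset.sum_const, ← Finset.sum_sub_distrib,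
    SimpleGraph.neighborFinset_eq_filter, Finset.sum_filter]

theorem exists_lapEig_eigenvector (j : V) :
    ∃ x : V → ℝ, x ≠ 0 ∧ G.lapMatrix ℝ *ᵥ x = lapEig G j • x := by
  have hA := G.isHermitian_lapMatrix ℝ
  refine ⟨hA.eigenvectorBasis j, fun h => ?_, hA.mulVec_eigenvectorBasis j⟩
  apply hA.eigenvectorBasis.orthonormal.ne_zero j
  ext i
  exact congrFun h i

variable {G}

theorem eigenvectorBasis_apply_eq (hG : G.Connected) {j : V} (hj : lapEig G j = 0) (v w : V) :
    (G.isHermitian_lapMatrix ℝ).eigenvectorBasis j v =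
      (G.isHermitian_lapMatrix ℝ).eigenvectorBasis j w := by
  have hA := G.isHermitian_lapMatrix ℝ
  have h : G.lapMatrix ℝ *ᵥ ⇑(hA.eigenvectorBasis j) = 0 := by
    rw [hA.mulVec_eigenvectorBasis j]
    change lapEig G j • _ = _
    rw [hj, zero_smul]
  rw [SimpleGraph.lapMatrix_mulVec_eq_zero_iff_forall_reachable] at h
  exact h v w (hG v w)

/-- A vector with zero coordinate sum is orthogonal to the eigenvectors for the eigenvalue zero. -/
theorem eigenvectorBasis_dotProduct_eq_zero (hG : G.Connected) {j : V} (hj : lapEig G j = 0)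
    {f : V → ℝ} (hf : ∑ v, f v = 0) :
    ⇑((G.isHermitian_lapMatrix ℝ).eigenvectorBasis j) ⬝ᵥ f = 0 := by
  simp only [dotProduct, eigenvectorBasis_apply_eq hG hj _ j, ← Finset.mul_sum, hf, mul_zero]

/-- Null vectors are constant when the graph is connected, and two nonzero constant vectors cannot
be orthogonal. -/
theorem lapEig_pos (hG : G.Connected) {i j : V} (hj : lapEig G j = 0) (hij : i ≠ j) :
    0 < lapEig G i := by
  refine lt_of_le_of_ne (lapEig_nonneg G i) fun hi => ?_
  have hA := G.isHermitian_lapMatrix ℝ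
  have key (k l : V) : inner ℝ (hA.eigenvectorBasis k) (hA.eigenvectorBasis l) =
      ⇑(hA.eigenvectorBasis l) ⬝ᵥ ⇑(hA.eigenvectorBasis k) := by
    rw [EuclideanSpace.inner_eq_star_dotProduct]; simp
  have h0 : ⇑(hA.eigenvectorBasis j) ⬝ᵥ ⇑(hA.eigenvectorBasis i) = 0 :=
    (key i j).symm.trans (hA.eigenvectorBasis.orthonormal.2 hij)
  simp only [dotProduct, eigenvectorBasis_apply_eq hG hi.symm _ i, ← Finset.sum_mul,
    mul_eq_zero] at h0
  rcases h0 with h0 | h0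
  · have h1 := key j j
    rw [real_inner_self_eq_norm_sq, hA.eigenvectorBasis.orthonormal.1 j,
      eigenvectorBasis_dotProduct_eq_zero hG hj h0] at h1
    norm_num at h1
  · apply hA.eigenvectorBasis.orthonormal.ne_zero i
    ext v
    rw [eigenvectorBasis_apply_eq hG hi.symm v i, h0]; rfl

/-- The variational upper bound for the second smallest Laplacian eigenvalue. -/
theorem exists_lapEig_le (hG : G.Connected) {j₀ : V} (hj₀ : lapEig G j₀ = 0) {f : V → ℝ}
    (hf : ∑ v, f v = 0) (hf0 : 0 < ∑ v, f v ^ 2) {c : ℝ}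
    (hc : f ⬝ᵥ (G.lapMatrix ℝ *ᵥ f) ≤ c * ∑ v, f v ^ 2) :
    ∃ j, j ≠ j₀ ∧ lapEig G j ≤ c := by
  by_contra! hlt
  have hA := G.isHermitian_lapMatrix ℝ
  set b := hA.eigenvectorBasis with hb
  have hin (x y : V → ℝ) : inner ℝ (WithLp.toLp 2 x) (WithLp.toLp 2 y) = x ⬝ᵥ y := by
    rw [EuclideanSpace.inner_eq_star_dotProduct]; simp [dotProduct_comm]
  have hin' (j : V) (y : V → ℝ) : inner ℝ (b j) (WithLp.toLp 2 y) = ⇑(b j) ⬝ᵥ y := hin _ _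
  have e1 : ∑ v, f v ^ 2 = ∑ j, (⇑(b j) ⬝ᵥ f) ^ 2 := by
    have := b.sum_inner_mul_inner (WithLp.toLp 2 f) (WithLp.toLp 2 f)
    rw [hin] at this
    simp only [real_inner_comm (b _) (WithLp.toLp 2 f), hin'] at this
    simp only [dotProduct, pow_two] at this ⊢
    exact this.symm
  have e2 : f ⬝ᵥ (G.lapMatrix ℝ *ᵥ f) = ∑ j, lapEig G j * (⇑(b j) ⬝ᵥ f) ^ 2 := by
    have := b.sum_inner_mul_inner (WithLp.toLp 2 f) (WithLp.toLp 2 (G.lapMatrix ℝ *ᵥ f))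
    rw [hin] at this
    rw [← this]
    refine Finset.sum_congr rfl fun j _ => ?_
    rw [real_inner_comm (b j) (WithLp.toLp 2 f), hin', hin', Matrix.dotProduct_mulVec,
      ← Matrix.mulVec_transpose, (G.isSymm_lapMatrix (R := ℝ)).eq, hb, hA.mulVec_eigenvectorBasis j,
      smul_dotProduct, smul_eq_mul]
    ring
  have hz : ⇑(b j₀) ⬝ᵥ f = 0 := eigenvectorBasis_dotProduct_eq_zero hG hj₀ hf
  obtain ⟨j, -, hj⟩ : ∃ j ∈ Finset.univ, (⇑(b j) ⬝ᵥ f) ^ 2 ≠ 0 := by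
    apply Finset.exists_ne_zero_of_sum_ne_zero
    rw [← e1]; exact hf0.ne'
  -- In eigencoordinates `f` has no `j₀` component, so if all other eigenvalues exceeded `c`, so
  -- would its Rayleigh quotient.
  have : c * ∑ v, f v ^ 2 < f ⬝ᵥ (G.lapMatrix ℝ *ᵥ f) := by
    rw [e1, e2, Finset.mul_sum]
    refine Finset.sum_lt_sum (fun i _ => ?_) ⟨j, Finset.mem_univ _, ?_⟩
    · rcases eq_or_ne i j₀ with rfl | hi
      · simp [hz]
      · exact mul_le_mul_of_nonneg_right (hlt i hi).le (sq_nonneg _)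
    · have hjj : j ≠ j₀ := by rintro rfl; simp [hz] at hj
      exact mul_lt_mul_of_pos_right (hlt j hjj) (lt_of_le_of_ne (sq_nonneg _) hj.symm)
  exact absurd hc this.not_ge

theorem sum_lapEig (G : SimpleGraph V) [DecidableRel G.Adj] :
    ∑ j, lapEig G j = 2 * (G.edgeFinset.card : ℝ) := by
  have h := (G.isHermitian_lapMatrix ℝ).trace_eq_sum_eigenvalues
  have h2 : (G.lapMatrix ℝ).trace = 2 * (G.edgeFinset.card : ℝ) := by
    have := G.sum_degrees_eq_twice_card_edges
    simp only [Matrix.trace, SimpleGraph.lapMatrix, SimpleGraph.degMatrix, Matrix.diag_apply,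
      Matrix.sub_apply, Matrix.diagonal_apply_eq, SimpleGraph.adjMatrix_apply, G.irrefl, if_false,
      sub_zero]
    exact_mod_cast this
  rw [← h2, h]
  rfl

end Spectrum

/-! ### Upper bound for the star -/

section Star

/-- If `0 < μ < 1`, summing the leaf equations and inserting the centre equation forces the centre
value to vanish; each leaf equation then kills its leaf. -/
theorem one_le_lapEig_star {q : ℕ} {j : Fin 1 ⊕ Fin q}
    (hj : lapEig (completeBipartiteGraph (Fin 1) (Fin q)) j ≠ 0) :
    1 ≤ lapEig (completeBipartiteGraph (Fin 1) (Fin q)) j := by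
  obtain ⟨x, hx, he⟩ := exists_lapEig_eigenvector (completeBipartiteGraph (Fin 1) (Fin q)) j
  have hpos := lt_of_le_of_ne (lapEig_nonneg _ j) hj.symm
  set μ := lapEig (completeBipartiteGraph (Fin 1) (Fin q)) j
  by_contra! hlt
  have hleaf (i : Fin q) : x (.inr i) - x (.inl 0) = μ * x (.inr i) := by
    have := congrFun he (.inr i)
    rw [lapMatrix_mulVec_apply_eq_sum] at this
    simpa using this
  have hcent : q * x (.inl 0) - ∑ i, x (.inr i) = μ * x (.inl 0) := by
    have := congrFun he (.inl 0)
    rw [lapMatrix_mulVec_apply_eq_sum] at this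
    simpa using this
  have hs : (1 - μ) * ∑ i, x (.inr i) = q * x (.inl 0) := by
    rw [Finset.mul_sum, Finset.sum_congr rfl (fun i _ => by linarith [hleaf i] :
      ∀ i ∈ Finset.univ, (1 - μ) * x (.inr i) = x (.inl 0))]
    simp
  have h0 : x (.inl 0) = 0 := by
    have : x (.inl 0) * (μ * (1 - μ + q)) = 0 := by
      linear_combination -(1 - μ) * hcent - hs
    have hq : (0 : ℝ) ≤ q := q.cast_nonneg
    have : μ * (1 - μ + q) ≠ 0 := (mul_pos hpos (by linarith)).ne'
    simp_all
  apply hx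
  ext v
  rcases v with v | i
  · rw [Subsingleton.elim v 0, h0]; rfl
  · have := hleaf i
    have h : (1 - μ) * x (.inr i) = 0 := by rw [h0] at this; linarith
    rcases mul_eq_zero.1 h with h | h
    · linarith
    · exact h

theorem BH_star_le (q : ℕ) :
    BH (completeBipartiteGraph (Fin 1) (Fin q)) ≤ ((q : ℝ) + 1) * q := by
  rw [BH_eq_card_mul_sum]
  have hc : (Fintype.card (Fin 1 ⊕ Fin q) : ℝ) = q + 1 := by
    simp [add_comm]
  obtain ⟨j₀, hj₀⟩ := exists_lapEig_eq_zero (completeBipartiteGraph (Fin 1) (Fin q))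
  rw [hc, ← Finset.add_sum_erase _ _ (Finset.mem_univ j₀), hj₀]
  refine mul_le_mul_of_nonneg_left ?_ (by positivity)
  have : ∑ j ∈ Finset.univ.erase j₀,
      (lapEig (completeBipartiteGraph (Fin 1) (Fin q)) j ^ 2)⁻¹ ≤
      ∑ j ∈ Finset.univ.erase j₀, (1 : ℝ) := by
    refine Finset.sum_le_sum fun j _ => ?_
    by_cases h : lapEig (completeBipartiteGraph (Fin 1) (Fin q)) j = 0
    · rw [h]; norm_num
    · exact inv_le_one_of_one_le₀ (one_le_pow₀ (one_le_lapEig_star h))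
  simpa using this

end Star

/-! ### Cosine vector of a path -/

section Path

/-- The Fiedler vector of the path on `m` vertices `0, …, m - 1`, with `θ = π / m`. -/
noncomputable def pathVec (θ : ℝ) (t : ℝ) : ℝ := Real.cos (θ * (t + 1 / 2))

theorem pathVec_rec (θ t : ℝ) :
    pathVec θ t + pathVec θ (t + 2) = 2 * Real.cos θ * pathVec θ (t + 1) := by
  unfold pathVec
  rw [show θ * (t + 1 / 2) = θ * (t + 1 + 1 / 2) - θ by ring,
    show θ * (t + 2 + 1 / 2) = θ * (t + 1 + 1 / 2) + θ by ring, Real.cos_sub, Real.cos_add]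
  ring

theorem pathVec_one (θ : ℝ) : pathVec θ 0 + pathVec θ 1 = 2 * Real.cos θ * pathVec θ 0 := by
  have h := pathVec_rec θ (-1)
  have h1 : pathVec θ (-1) = pathVec θ 0 := by
    unfold pathVec
    rw [← Real.cos_neg]; congr 1; ring
  rw [h1] at h
  norm_num at h
  exact h

/-- The cosine is symmetric about `d + 1/2`. This reflecting end condition removes the boundary
terms in `pathVec_energy` and `pathVec_sum`. -/
theorem pathVec_succ_eq {d : ℕ} {θ : ℝ} (hθ : θ * (d + 1) = Real.pi) :
    pathVec θ (d + 1 : ℕ) = pathVec θ d := by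
  unfold pathVec
  push_cast
  rw [show θ * ((d : ℝ) + 1 + 1 / 2) = Real.pi + θ / 2 by linear_combination hθ,
    show θ * ((d : ℝ) + 1 / 2) = Real.pi - θ / 2 by linear_combination hθ, Real.cos_pi_sub,
    add_comm, Real.cos_add_pi]

/-- Summation by parts, with the right boundary term kept so that induction on `m` works. -/
theorem pathVec_energy (θ : ℝ) (m : ℕ) :
    ∑ k ∈ Finset.range m, (pathVec θ k - pathVec θ (k + 1 : ℕ)) ^ 2 +
      pathVec θ m * (pathVec θ m - pathVec θ (m + 1 : ℕ)) =
    (2 - 2 * Real.cos θ) * ∑ k ∈ Finset.range (m + 1), pathVec θ k ^ 2 := by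
  induction m with
  | zero =>
    simp only [Finset.range_zero, Finset.sum_empty, zero_add, Finset.sum_range_one, Nat.cast_zero,
      Nat.cast_one]
    linear_combination -(pathVec θ 0) * pathVec_one θ
  | succ m ih =>
    rw [Finset.sum_range_succ, Finset.sum_range_succ _ (m + 1), mul_add, ← ih]
    have h := pathVec_rec θ m
    push_cast at h ⊢
    rw [show (m : ℝ) + 1 + 1 = m + 2 by ring]
    linear_combination -(pathVec θ (m + 1)) * h

theorem pathVec_sum (θ : ℝ) (m : ℕ) :
    pathVec θ m - pathVec θ (m + 1 : ℕ) =
    (2 - 2 * Real.cos θ) * ∑ k ∈ Finset.range (m + 1), pathVec θ k := by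
  induction m with
  | zero =>
    simp only [zero_add, Finset.sum_range_one, Nat.cast_zero, Nat.cast_one]
    linear_combination -pathVec_one θ
  | succ m ih =>
    rw [Finset.sum_range_succ _ (m + 1), mul_add, ← ih]
    have h := pathVec_rec θ m
    push_cast at h ⊢
    rw [show (m : ℝ) + 1 + 1 = m + 2 by ring]
    linear_combination -h

end Path

/-! ### Projection of a tree onto a geodesic -/

section Tree

variable {V : Type*} {T : SimpleGraph V}

/-- In a tree, an edge pointing from `a` towards `b` lies on every walk from `a` to `b`. -/
theorem mem_edges_of_dist_lt (hT : T.IsTree) {a b u v : V} (huv : T.Adj u v) (p : T.Walk a b)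
    (hu : T.dist a u < T.dist a v) (hv : T.dist b v < T.dist b u) : s(u, v) ∈ p.edges := by
  classical
  obtain ⟨q, hq⟩ := hT.connected.exists_walk_length_eq_dist a u
  obtain ⟨r, hr⟩ := hT.connected.exists_walk_length_eq_dist b v
  have hb := SimpleGraph.isAcyclic_iff_forall_adj_isBridge.1 hT.isAcyclic huv
  -- The walk `u → a → b → v` must cross the bridge `uv`; its two outer geodesics cannot, by the
  -- distance inequalities.
  have := SimpleGraph.isBridge_iff_forall_walk_mem_edges.1 hb (q.reverse.append (p.append r))
  simp only [SimpleGraph.Walk.edges_append, SimpleGraph.Walk.edges_reverse, List.mem_append,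
    List.mem_reverse] at this
  rcases this with h | h | h
  · have hs := q.snd_mem_support_of_mem_edges h
    have h1 := SimpleGraph.dist_le (q.takeUntil v hs)
    have h2 := q.length_takeUntil_le_length hs
    omega
  · exact h
  · have hs := r.fst_mem_support_of_mem_edges h
    have h1 := SimpleGraph.dist_le (r.takeUntil u hs)
    have h2 := r.length_takeUntil_le_length hs
    omega

theorem dist_getVert_of_length_eq_dist (hT : T.Connected) {a b : V} (p : T.Walk a b)
    (hp : p.length = T.dist a b) {k : ℕ} (hk : k ≤ p.length) :
    T.dist a (p.getVert k) = k ∧ T.dist b (p.getVert k) = p.length - k := by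
  have h1 := SimpleGraph.dist_le (p.take k)
  have h2 := SimpleGraph.dist_le (p.drop k)
  have h3 := hT.dist_triangle (u := a) (v := p.getVert k) (w := b)
  rw [SimpleGraph.Walk.take_length] at h1
  rw [SimpleGraph.Walk.drop_length] at h2
  rw [T.dist_comm (u := b)]
  omega

/-- The position on the geodesic from `a` to `b` of the projection of `v`. -/
noncomputable def proj (T : SimpleGraph V) (a b v : V) : ℝ :=
  ((T.dist a v : ℝ) - T.dist b v + T.dist a b) / 2

theorem proj_getVert (hT : T.Connected) {a b : V} (p : T.Walk a b)
    (hp : p.length = T.dist a b) {k : ℕ} (hk : k ≤ p.length) :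
    proj T a b (p.getVert k) = k := by
  obtain ⟨h1, h2⟩ := dist_getVert_of_length_eq_dist hT p hp hk
  rw [proj, h1, h2, Nat.cast_sub hk, ← hp]
  ring

/-- Along a tree edge each of the distances to `a` and `b` changes by exactly one. The projection
moves only if they change oppositely, so the edge separates `a` from `b`. -/
theorem exists_getVert_of_proj_ne (hT : T.IsTree) {a b u v : V} (p : T.Walk a b)
    (huv : T.Adj u v) (h : proj T a b u ≠ proj T a b v) :
    ∃ k < p.length, s(p.getVert k, p.getVert (k + 1)) = s(u, v) := by
  rw [← SimpleGraph.Walk.mk_mem_edges_iff_exists]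
  rcases hT.dist_eq_dist_add_one_of_adj a huv with ha | ha <;>
    rcases hT.dist_eq_dist_add_one_of_adj b huv with hb | hb
  · exact absurd (by simp only [proj, ha, hb]; push_cast; ring) h
  · rw [Sym2.eq_swap]
    exact mem_edges_of_dist_lt hT huv.symm p (by omega) (by omega)
  · exact mem_edges_of_dist_lt hT huv p (by omega) (by omega)
  · exact absurd (by simp only [proj, ha, hb]; push_cast; ring) h

variable [Fintype V] [DecidableEq V] [DecidableRel T.Adj]

theorem energy_comp_proj_le (hT : T.IsTree) {a b : V} (p : T.Walk a b)
    (hp : p.length = T.dist a b) (φ : ℝ → ℝ) (m : ℝ) :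
    (fun v => φ (proj T a b v) - m) ⬝ᵥ
      (T.lapMatrix ℝ *ᵥ fun v => φ (proj T a b v) - m) ≤
    ∑ k ∈ Finset.range p.length, (φ k - φ (k + 1 : ℕ)) ^ 2 := by
  rw [← Matrix.toLinearMap₂'_apply', SimpleGraph.lapMatrix_toLinearMap₂', div_le_iff₀ two_pos]
  simp only [sub_sub_sub_cancel_right]
  set F : V → V → ℝ := fun i j => (φ (proj T a b i) - φ (proj T a b j)) ^ 2 with hF
  have hFk : ∀ k ∈ Finset.range p.length,
      F (p.getVert k) (p.getVert (k + 1)) = (φ k - φ (k + 1 : ℕ)) ^ 2 := by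
    intro k hk
    rw [Finset.mem_range] at hk
    simp only [hF]
    rw [proj_getVert hT.connected p hp hk.le, proj_getVert hT.connected p hp hk]
  have hsw : ∀ i j, F i j = F j i := fun i j => by simp only [hF]; ring
  have hnn : ∀ i j, 0 ≤ F i j := fun i j => sq_nonneg _
  -- The quadratic form is half a sum over ordered pairs, hence one indicator for each orientation
  -- of a path edge.
  have hpt : ∀ i j, (if T.Adj i j then F i j else 0) ≤ ∑ k ∈ Finset.range p.length,
      ((if p.getVert k = i ∧ p.getVert (k + 1) = j then F i j else 0) +
        (if p.getVert k = j ∧ p.getVert (k + 1) = i then F i j else 0)) := by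
    intro i j
    have hterm : ∀ k ∈ Finset.range p.length,
      0 ≤ ((if p.getVert k = i ∧ p.getVert (k + 1) = j then F i j else 0) +
        (if p.getVert k = j ∧ p.getVert (k + 1) = i then F i j else 0)) := by
      intro k _
      have := hnn i j
      positivity
    by_cases hz : T.Adj i j ∧ proj T a b i ≠ proj T a b j
    · obtain ⟨k, hk, he⟩ := exists_getVert_of_proj_ne hT p hz.1 hz.2
      rw [if_pos hz.1]
      refine le_trans ?_ (Finset.single_le_sum hterm (Finset.mem_range.2 hk))
      have := hnn i j
      rcases Sym2.eq_iff.1 he with h | h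
      · rw [if_pos h]; split_ifs <;> linarith
      · rw [if_pos h]; split_ifs <;> linarith
    · refine le_trans (le_of_eq ?_) (Finset.sum_nonneg hterm)
      split_ifs with h
      · have : proj T a b i = proj T a b j := by
          by_contra h'; exact hz ⟨h, h'⟩
        simp [hF, this]
      · rfl
  calc ∑ i, ∑ j, (if T.Adj i j then F i j else 0)
      ≤ ∑ i, ∑ j, ∑ k ∈ Finset.range p.length,
      ((if p.getVert k = i ∧ p.getVert (k + 1) = j then F i j else 0) +
        (if p.getVert k = j ∧ p.getVert (k + 1) = i then F i j else 0)) :=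
        Finset.sum_le_sum fun i _ => Finset.sum_le_sum fun j _ => hpt i j
    _ = ∑ k ∈ Finset.range p.length, (F (p.getVert k) (p.getVert (k + 1)) +
        F (p.getVert (k + 1)) (p.getVert k)) := by
      simp only [Finset.sum_comm (t := Finset.range p.length)]
      refine Finset.sum_congr rfl fun k _ => ?_
      simp only [Finset.sum_add_distrib, ite_and]
      congr 1
      · simp
      · rw [Finset.sum_comm]; simp
    _ = _ := by
      rw [Finset.sum_mul]
      refine Finset.sum_congr rfl fun k hk => ?_
      rw [hsw (p.getVert (k + 1)), hFk k hk]; ring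

/-- The algebraic connectivity of a tree is at most that of its longest path. -/
theorem exists_lapEig_le_of_tree (hT : T.IsTree) {a b : V} (hab : a ≠ b) {j₀ : V}
    (hj₀ : lapEig T j₀ = 0) :
    ∃ j, j ≠ j₀ ∧ lapEig T j ≤ (Real.pi / (T.dist a b + 1)) ^ 2 := by
  obtain ⟨p, hp⟩ := hT.connected.exists_walk_length_eq_dist a b
  have hd : 0 < T.dist a b := hT.connected.pos_dist_of_ne hab
  set d := T.dist a b with hdd
  set θ : ℝ := Real.pi / (d + 1) with hθdef
  have hθ : θ * (d + 1) = Real.pi := div_mul_cancel₀ _ (by positivity)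
  have hθ0 : 0 < θ := div_pos Real.pi_pos (by positivity)
  have hθ2 : θ ≤ Real.pi / 2 := by
    have : (1 : ℝ) ≤ d := by exact_mod_cast hd
    exact div_le_div_of_nonneg_left Real.pi_pos.le two_pos (by linarith)
  have hcos : Real.cos θ < 1 := by
    rw [← Real.cos_zero]
    exact Real.cos_lt_cos_of_nonneg_of_le_pi_div_two le_rfl hθ2 hθ0
  have hsum : ∑ k ∈ Finset.range (d + 1), pathVec θ k = 0 := by
    have h := pathVec_sum θ d
    rw [pathVec_succ_eq hθ, sub_self] at h
    rcases mul_eq_zero.1 h.symm with h | h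
    · linarith
    · exact h
  have hen := pathVec_energy θ d
  rw [pathVec_succ_eq hθ, sub_self, mul_zero, add_zero] at hen
  set g : V → ℝ := fun v => pathVec θ (proj T a b v) with hg
  set m : ℝ := (∑ v, g v) / Fintype.card V with hm
  have hinj : Set.InjOn p.getVert (Finset.range (d + 1)) := by
    intro k hk l hl h
    simp only [Finset.coe_range, Set.mem_Iio] at hk hl
    have h1 := proj_getVert hT.connected p hp (k := k) (by omega)
    have h2 := proj_getVert hT.connected p hp (k := l) (by omega)
    rw [h, h2] at h1
    exact_mod_cast h1.symm
  -- As the path values sum to zero, shifting them by `m` only adds `(d+1)m²`; vertices off the path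
  -- add nonnegative terms.
  have hnorm : ∑ k ∈ Finset.range (d + 1), pathVec θ k ^ 2 ≤ ∑ v, (g v - m) ^ 2 := by
    calc ∑ k ∈ Finset.range (d + 1), pathVec θ k ^ 2
        ≤ ∑ k ∈ Finset.range (d + 1), pathVec θ k ^ 2 + (d + 1) * m ^ 2 := by
          have : (0 : ℝ) ≤ (d + 1) * m ^ 2 := by positivity
          linarith
      _ = ∑ k ∈ Finset.range (d + 1), (pathVec θ k - m) ^ 2 := by
          simp only [sub_sq, Finset.sum_add_distrib, Finset.sum_sub_distrib, ← Finset.sum_mul,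
            ← Finset.mul_sum, hsum]
          simp
      _ = ∑ v ∈ (Finset.range (d + 1)).image p.getVert, (g v - m) ^ 2 := by
          rw [Finset.sum_image hinj]
          refine Finset.sum_congr rfl fun k hk => ?_
          rw [Finset.mem_range] at hk
          simp only [hg]
          rw [proj_getVert hT.connected p hp (by omega)]
      _ ≤ _ := Finset.sum_le_sum_of_subset_of_nonneg (Finset.subset_univ _)
          fun _ _ _ => sq_nonneg _
  have hpos : 0 < ∑ k ∈ Finset.range (d + 1), pathVec θ k ^ 2 := by
    refine Finset.sum_pos' (fun _ _ => sq_nonneg _) ⟨0, by simp, ?_⟩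
    refine pow_pos ?_ 2
    unfold pathVec
    apply Real.cos_pos_of_mem_Ioo
    constructor <;> push_cast <;> linarith
  have hzero : ∑ v, (g v - m) = 0 := by
    have : (Fintype.card V : ℝ) ≠ 0 := by
      exact_mod_cast (Fintype.card_pos_iff.2 ⟨a⟩).ne'
    rw [Finset.sum_sub_distrib, Finset.sum_const, Finset.card_univ, nsmul_eq_mul, hm,
      mul_div_cancel₀ _ this, sub_self]
  refine exists_lapEig_le hT.connected hj₀ hzero (hpos.trans_le hnorm) ?_
  have hle : 2 - 2 * Real.cos θ ≤ θ ^ 2 := by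
    linarith [Real.one_sub_sq_div_two_le_cos (x := θ)]
  calc _ ≤ _ := energy_comp_proj_le hT p hp (pathVec θ) m
    _ = (2 - 2 * Real.cos θ) * ∑ k ∈ Finset.range (d + 1), pathVec θ k ^ 2 := by rw [hp, hen]
    _ ≤ θ ^ 2 * ∑ v, (g v - m) ^ 2 :=
      mul_le_mul hle hnorm hpos.le (sq_nonneg _)

/-- Tangent line at `x = 2`; clearing denominators leaves `(x-2)²(x+1) ≥ 0`. -/
theorem inv_sq_ge_tangent {x : ℝ} (hx : 0 < x) : 3 / 4 - x / 4 ≤ (x ^ 2)⁻¹ := by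
  rw [← one_div, le_div_iff₀ (by positivity)]
  nlinarith [mul_nonneg (sq_nonneg (x - 2)) (by linarith : 0 ≤ x + 1)]

theorem sum_inv_sq_lapEig_ge_of_tree (hT : T.IsTree) {a b : V} (hab : a ≠ b) :
    (((T.dist a b : ℝ) + 1) / Real.pi) ^ 4 + ((Fintype.card V : ℝ) - 4) / 4 ≤
      ∑ j, (lapEig T j ^ 2)⁻¹ := by
  have : Nonempty V := ⟨a⟩
  obtain ⟨j₀, hj₀⟩ := exists_lapEig_eq_zero T
  obtain ⟨j, hj, hle⟩ := exists_lapEig_le_of_tree hT hab hj₀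
  have hjpos := lapEig_pos hT.connected hj₀ hj
  have hmem : j ∈ Finset.univ.erase j₀ := by simp [hj]
  have htrace := sum_lapEig T
  have hedge : (T.edgeFinset.card : ℝ) + 1 = Fintype.card V := by
    exact_mod_cast hT.card_edgeFinset
  rw [← Finset.add_sum_erase _ _ (Finset.mem_univ j₀), ← Finset.add_sum_erase _ _ hmem, hj₀]
    at htrace ⊢
  have h1 : (((T.dist a b : ℝ) + 1) / Real.pi) ^ 4 ≤ (lapEig T j ^ 2)⁻¹ := by
    have hp : (0 : ℝ) < Real.pi / (T.dist a b + 1) := div_pos Real.pi_pos (by positivity)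
    rw [← inv_div, inv_pow]
    apply inv_anti₀ (by positivity)
    calc lapEig T j ^ 2 ≤ ((Real.pi / (T.dist a b + 1)) ^ 2) ^ 2 :=
          pow_le_pow_left₀ hjpos.le hle 2
      _ = _ := by ring
  have h2 : ∑ i ∈ (Finset.univ.erase j₀).erase j, (3 / 4 - lapEig T i / 4) ≤
      ∑ i ∈ (Finset.univ.erase j₀).erase j, (lapEig T i ^ 2)⁻¹ := by
    refine Finset.sum_le_sum fun i hi => inv_sq_ge_tangent (lapEig_pos hT.connected hj₀ ?_)
    simp only [Finset.mem_erase] at hi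
    exact hi.2.1
  have hcard : (((Finset.univ.erase j₀).erase j).card : ℝ) = Fintype.card V - 2 := by
    have h3 := Finset.card_erase_add_one hmem
    have h4 := Finset.card_erase_add_one (Finset.mem_univ j₀)
    rw [Finset.card_univ] at h4
    have : ((Finset.univ.erase j₀).erase j).card + 2 = Fintype.card V := by omega
    rw [← this]; push_cast; ring
  rw [Finset.sum_sub_distrib, Finset.sum_const, nsmul_eq_mul, hcard, ← Finset.sum_div] at h2
  -- With `λ` the singled-out eigenvalue, the tangent bounds sum to `3(n-2)/4 - (2(n-1) - λ)/4 =
  -- (n-4)/4 + λ/4`.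
  norm_num
  linarith

end Tree

end Biharmonic

theorem theorem5p2 {V : Type*} [Fintype V] [DecidableEq V] (T : SimpleGraph V)
    [DecidableRel T.Adj] (n : ℕ) (hcard : Fintype.card V = n) (hn : 8 ≤ n) (hT : T.IsTree)
    (hdiam : Real.pi * (7 * (n : ℝ) / 8) ^ ((1 : ℝ) / 4) - 1 ≤ (T.diam : ℝ)) :
    Biharmonic.BH (completeBipartiteGraph (Fin 1) (Fin (n - 1))) < Biharmonic.BH T := by
  have hn' : (8 : ℝ) ≤ n := by exact_mod_cast hn
  have : Nonempty V := hT.connected.nonempty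
  obtain ⟨a, b, hab⟩ := T.exists_dist_eq_diam
  have hroot : (1 : ℝ) ≤ (7 * (n : ℝ) / 8) ^ ((1 : ℝ) / 4) :=
    Real.one_le_rpow (by linarith) (by norm_num)
  -- The assumed lower bound on the diameter is at least `π - 1 > 0`.
  have hne : a ≠ b := by
    rintro rfl
    rw [SimpleGraph.dist_self] at hab
    rw [← hab, Nat.cast_zero] at hdiam
    nlinarith [Real.pi_gt_three]
  have hpow : 7 * (n : ℝ) / 8 ≤ (((T.dist a b : ℝ) + 1) / Real.pi) ^ 4 := by
    have h : (7 * (n : ℝ) / 8) ^ ((1 : ℝ) / 4) ≤ ((T.dist a b : ℝ) + 1) / Real.pi := by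
      rw [le_div_iff₀ Real.pi_pos, hab]
      linarith
    calc 7 * (n : ℝ) / 8 = ((7 * (n : ℝ) / 8) ^ ((1 : ℝ) / 4)) ^ 4 := by
          rw [← Real.rpow_natCast, ← Real.rpow_mul (by positivity)]
          norm_num
      _ ≤ _ := pow_le_pow_left₀ (by linarith) h 4
  have hlow := Biharmonic.sum_inv_sq_lapEig_ge_of_tree hT hne
  have hstar := Biharmonic.BH_star_le (n - 1)
  rw [Nat.cast_sub (by omega), Nat.cast_one, sub_add_cancel] at hstar
  rw [Biharmonic.BH_eq_card_mul_sum T, hcard]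
  rw [hcard] at hlow
  refine hstar.trans_lt (mul_lt_mul_of_pos_left ?_ (by linarith))
  linarith
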